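/- Let $F$ be a henselian valued field, i.e. a field with a valuation $v$ (of arbitrary rank) whose valuation ring is a henselian local ring; equip $F$ with the topology defined by $v$. Then $F$ is topologically henselian, that is: $F$ is a Hausdorff topological field and, for every étale $F$-morphism $f: X\to Y$ of $F$-varieties, the induced map $f_{\mathrm{top}}: X(F)\to Y(F)$ on rational points is a local homeomorphism. Here an $F$-variety is an $F$-scheme of finite type (not necessarily separated, reduced or irreducible), and, for such $X$, the set $X(F)$ of $F$-morphisms $\operatorname{Spec} F\to X$ carries the topology deduced from that of $F$: the coarsest topology for which, for every Zariski open $U\subseteq X$, the subset $U(F)$ is open in $X(F)$ and every regular function $s\in\Gamma(U,\mathcal O_X)$ induces a continuous map $U(F)\to F$, $x\mapsto s(x)$. -/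

import Mathlib

open CategoryTheory AlgebraicGeometry

universe u v

/-- The spectrum of a field, in the bundled form used below. -/
noncomputable abbrev specField (F : Type u) [Field F] : Scheme.{u} :=
  Spec (CommRingCat.of F)

/-- An `F`-variety is an `F`-scheme of finite type, i.e. locally of finite type and quasi-compact. -/
structure IsVariety {F : Type u} [Field F] (X : Over (specField F)) : Prop where
  locallyOfFiniteType : LocallyOfFiniteType X.hom
  quasiCompact : QuasiCompact X.hom

/-- The set `X(F)` of `F`-rational points of an `F`-scheme `X`: the `F`-morphisms `Spec F ⟶ X`. -/
def RationalPoints {F : Type u} [Field F] (X : Over (specField F)) : Type u :=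
  Over.mk (𝟙 (specField F)) ⟶ X

namespace RationalPoints

variable {F : Type u} [Field F] {X Y : Over (specField F)}

/-- The morphism of schemes `Spec F ⟶ X` underlying a rational point. -/
def hom (x : RationalPoints X) : specField F ⟶ X.left :=
  CommaMorphism.left x

/-- The rational point `x` lies in the Zariski open `U`, i.e. belongs to `U(F) ⊆ X(F)`. -/
def LiesIn (x : RationalPoints X) (U : X.left.Opens) : Prop :=
  ⊤ ≤ x.hom ⁻¹ᵁ U

/-- The value `s(x) ∈ F` of a regular function `s ∈ Γ(X, U)` at a rational point `x ∈ U(F)`: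
the image of `s` under `Γ(X, U) ⟶ Γ(Spec F, ⊤) ≅ F`. -/
noncomputable def eval (x : RationalPoints X) {U : X.left.Opens} (hx : x.LiesIn U)
    (s : Γ(X.left, U)) : F :=
  (Scheme.ΓSpecIso (CommRingCat.of F)).hom (x.hom.appLE U ⊤ hx s)

/-- The topology on `X(F)` deduced from the topology of `F`: the coarsest one for which, for every
Zariski open `U` of `X`, the subset `U(F)` is open and every regular function `s ∈ Γ(X, U)`
induces a continuous function `U(F) → F`. -/
instance instTopologicalSpace [TopologicalSpace F] : TopologicalSpace (RationalPoints X) :=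
  TopologicalSpace.generateFrom
    {S | ∃ (U : X.left.Opens) (s : Γ(X.left, U)) (Ω : Set F), IsOpen Ω ∧
      S = {x | ∃ hx : x.LiesIn U, x.eval hx s ∈ Ω}}

/-- The map `X(F) → Y(F)` induced by an `F`-morphism `f : X ⟶ Y`. -/
noncomputable def map (f : X ⟶ Y) (x : RationalPoints X) : RationalPoints Y :=
  CategoryStruct.comp (obj := Over (specField F)) x f

end RationalPoints

/-- A topological field `F` is topologically henselian if it is Hausdorff and every étale morphism
of `F`-varieties `f : X ⟶ Y` induces a local homeomorphism `X(F) → Y(F)`. -/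
structure IsTopologicallyHenselian (F : Type u) [Field F] [TopologicalSpace F] : Prop where
  isTopologicalDivisionRing : IsTopologicalDivisionRing F
  t2Space : T2Space F
  isLocalHomeomorph_map : ∀ (X Y : Over (specField F)), IsVariety X → IsVariety Y →
    ∀ f : X ⟶ Y, Etale f.left → IsLocalHomeomorph (RationalPoints.map f)

/-! Locally an étale morphism is standard étale, `S = (R[x]/f)_g` with `f'` invertible in `S`, and
the `F`-points of an affine open form an open subset of `X(F)` whose topology is pointwise
convergence on algebra maps (`isOpenEmbedding_ofAlgHom`). It remains to study `Hom(S, F) → Hom(R,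
F)`, where a point of `S` is a point of `R` with a root of `f` at which `g ≠ 0`. The map is locally
injective because the divided difference of `f` stays nonzero near a simple root
(`exists_mem_nhds_injOn`). It is open because simple roots persist, and stay close, when the
coefficients move (`eventually_exists_root`). Only this last point uses that the valuation is
henselian, through a Newton form of Hensel's lemma valid in any rank. -/

open Polynomial Topology Filter

/-! ### Hensel's lemma in Newton form -/

section Hensel

variable {F : Type*} [Field F] {Γ₀ : Type*} [LinearOrderedCommGroupWithZero Γ₀]

/-- Over a henselian valuation ring, a polynomial `X ^ (n + 2) + X ^ (n + 1) + ...` whose remaining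
coefficients lie in the maximal ideal has a unit root. -/
theorem HenselianLocalRing.exists_isUnit_root {O : Type*} [CommRing O] [HenselianLocalRing O]
    (n : ℕ) (e : ℕ → O) (he : ∀ i, e i ∈ IsLocalRing.maximalIdeal O) :
    ∃ w : O, IsUnit w ∧
      w ^ (n + 2) + w ^ (n + 1) + ∑ i ∈ Finset.range (n + 1), e i * w ^ (n - i) = 0 := by
  set r : O[X] := ∑ i ∈ Finset.range (n + 1), C (e i) * X ^ (n - i) with hr
  have hdeg : r.degree < (n + 1 : ℕ) := by
    refine (degree_sum_le _ _).trans_lt ?_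
    rw [Finset.sup_lt_iff (WithBot.bot_lt_coe _)]
    intro i _
    refine (degree_C_mul_X_pow_le _ _).trans_lt ?_
    exact_mod_cast Nat.lt_succ_of_le (Nat.sub_le n i)
  have hmonic : (X ^ (n + 2) + (X ^ (n + 1) + r)).Monic := by
    refine monic_X_pow_add ((degree_add_le _ _).trans_lt (max_lt ?_ ?_))
    · refine (degree_X_pow_le _).trans_lt ?_
      exact_mod_cast Nat.lt_succ_self _
    · exact hdeg.trans (by exact_mod_cast Nat.lt_succ_self _)
  have hr0 : ∀ a, r.eval a ∈ IsLocalRing.maximalIdeal O := by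
    intro a
    simp only [hr, eval_finsetSum, eval_mul, eval_C]
    exact Ideal.sum_mem _ fun i _ ↦ Ideal.mul_mem_right _ _ (he i)
  have hr1 : ∀ a, r.derivative.eval a ∈ IsLocalRing.maximalIdeal O := by
    intro a
    simp only [hr, derivative_sum, derivative_C_mul, eval_finsetSum, eval_mul, eval_C]
    exact Ideal.sum_mem _ fun i _ ↦ Ideal.mul_mem_right _ _ (he i)
  -- Modulo the maximal ideal the polynomial is `X ^ (n + 1) * (X + 1)`, with simple root `-1`.
  obtain ⟨w, hw, hw'⟩ := HenselianLocalRing.is_henselian _ hmonic (-1) (by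
    have : eval (-1) (X ^ (n + 2) + (X ^ (n + 1) + r)) = eval (-1) r := by
      simp; ring
    rw [this]; exact hr0 _) (by
    have : eval (-1) (derivative (X ^ (n + 2) + (X ^ (n + 1) + r)))
        = (-1) ^ (n + 1) + eval (-1) (derivative r) := by
      simp; ring
    rw [this]
    by_contra h
    have := Ideal.sub_mem _ ((IsLocalRing.mem_maximalIdeal _).mpr h) (hr1 (-1))
    rw [add_sub_cancel_right, IsLocalRing.mem_maximalIdeal] at this
    exact this ((isUnit_one.neg).pow _))
  refine ⟨w, ?_, ?_⟩
  · by_contra h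
    have := Ideal.sub_mem _ hw' ((IsLocalRing.mem_maximalIdeal _).mpr h)
    rw [IsLocalRing.mem_maximalIdeal] at this
    apply this
    have e : w - -1 - w = 1 := by ring
    rw [e]; exact isUnit_one
  · simpa [hr, eval_finsetSum, add_assoc] using hw

/-- Hensel's lemma in Newton form for a possibly non-monic polynomial. -/
theorem Valuation.exists_eval_eq_zero_of_henselian (v : Valuation F Γ₀)
    [HenselianLocalRing v.valuationSubring] (q : F[X]) (h1 : q.coeff 1 ≠ 0)
    (h : ∀ i ∈ Finset.range (q.natDegree + 1),
      v (q.coeff (i + 2) * q.coeff 0 ^ (i + 1)) < v (q.coeff 1 ^ (i + 2))) :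
    ∃ z, q.eval z = 0 ∧ v z = v (q.coeff 0 / q.coeff 1) := by
  by_cases h0 : q.coeff 0 = 0
  · exact ⟨0, by rw [← coeff_zero_eq_eval_zero, h0], by simp [h0]⟩
  set n := q.natDegree
  -- Write `c i` for `q.coeff i`. Substituting `z = c 0 / (c 1 * w)` in `q` and multiplying by `w ^
  -- (n + 2) / c 0` gives a monic polynomial in `w` with lower coefficients `e i`. Using degree `n +
  -- 2` rather than `n` only adds zero coefficients.
  set e : ℕ → F := fun i ↦ q.coeff (i + 2) * q.coeff 0 ^ (i + 1) / q.coeff 1 ^ (i + 2) with he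
  have hlt : ∀ i, v (e i) < 1 := by
    intro i
    by_cases hi : i ∈ Finset.range (n + 1)
    · rw [he, map_div₀, div_lt_one₀ (by simpa [zero_lt_iff] using h1)]
      exact h i hi
    · have : q.coeff (i + 2) = 0 := coeff_eq_zero_of_natDegree_lt (by
        simp only [Finset.mem_range] at hi; omega)
      simp [he, this]
  have hO : v.Integers v.valuationSubring := Valuation.valuationSubring.integers v
  obtain ⟨w, hw, hw0⟩ := HenselianLocalRing.exists_isUnit_root (O := v.valuationSubring) n
    (fun i ↦ ⟨e i, (hlt i).le⟩) (fun i ↦ by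
      rw [IsLocalRing.mem_maximalIdeal, mem_nonunits_iff, hO.isUnit_iff_valuation_eq_one]
      exact (hlt i).ne)
  have hv : v (w : F) = 1 := hO.isUnit_iff_valuation_eq_one.mp hw
  have hwne : (w : F) ≠ 0 := fun h ↦ by simp [h] at hv
  refine ⟨q.coeff 0 / (q.coeff 1 * w), ?_, by simp [hv]⟩
  have hw0' : (w : F) ^ (n + 2) + (w : F) ^ (n + 1)
      + ∑ i ∈ Finset.range (n + 1), e i * (w : F) ^ (n - i) = 0 := by
    simpa using congr((($hw0 : v.valuationSubring) : F))
  have key : q.eval (q.coeff 0 / (q.coeff 1 * w)) = q.coeff 0 / (w : F) ^ (n + 2) *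
      ((w : F) ^ (n + 2) + (w : F) ^ (n + 1)
        + ∑ i ∈ Finset.range (n + 1), e i * (w : F) ^ (n - i)) := by
    rw [eval_eq_sum_range' (n := n + 1 + 2) (by omega), Finset.sum_range_succ',
      Finset.sum_range_succ', mul_add, Finset.mul_sum, add_assoc, add_comm]
    congr 1
    · simp only [zero_add, pow_zero, pow_one, mul_one]
      field_simp
      ring
    · refine Finset.sum_congr rfl fun i hi ↦ ?_
      obtain ⟨k, hk⟩ := Nat.exists_eq_add_of_le (Nat.lt_succ_iff.mp (Finset.mem_range.mp hi))
      simp only [he, hk, Nat.add_sub_cancel_left, add_assoc, Nat.reduceAdd, div_pow, mul_pow]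
      field_simp
      ring
  rw [key, hw0', mul_zero]

end Hensel

/-! ### Valuation estimates near a point -/

section Valued

variable {F : Type*} [Field F] {Γ₀ : Type*} [LinearOrderedCommGroupWithZero Γ₀] [Valued F Γ₀]

theorem Valued.setOf_v_lt_mem_nhds_zero {d : F} (hd : d ≠ 0) :
    {x : F | Valued.v x < Valued.v d} ∈ 𝓝 (0 : F) := by
  rw [Valued.mem_nhds_zero]
  have h' : (Valued.v.restrict d : _) ≠ 0 := by simp [hd]
  refine ⟨Units.mk0 _ h', fun y hy ↦ ?_⟩
  exact Valuation.restrict_lt_iff _ |>.mp hy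

/-- Radii of basic neighbourhoods lie in the value group of the image of `v`, so each is attained by
an element of `F`. -/
theorem Valued.exists_setOf_v_lt_subset {s : Set F} {a : F} (hs : s ∈ 𝓝 a) :
    ∃ d : F, d ≠ 0 ∧ ∀ x, Valued.v (x - a) < Valued.v d → x ∈ s := by
  obtain ⟨γ, hγ⟩ := Valued.mem_nhds.mp hs
  obtain ⟨d, hd : Valued.v.restrict d = γ.1⟩ :=
    MonoidWithZeroHom.ValueGroup₀.restrict₀_surjective (.ofClass (Valued.v : Valuation F Γ₀)) γ.1
  refine ⟨d, ?_, fun x hx ↦ hγ ?_⟩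
  · rintro rfl
    exact γ.ne_zero (by simpa using hd.symm)
  · rw [Set.mem_ofPred_eq, ← hd]
    exact (Valuation.restrict_lt_iff _).mpr hx

/-- The valuation is locally constant away from `0`, so the right side is frozen near `z` while `g`
becomes small. -/
theorem Valued.eventually_v_lt {Z : Type*} [TopologicalSpace Z] {g h : Z → F} {z : Z}
    (hg : ContinuousAt g z) (hh : ContinuousAt h z) (hg0 : g z = 0) (hh0 : h z ≠ 0) :
    ∀ᶠ y in 𝓝 z, Valued.v (g y) < Valued.v (h y) := by
  have h1 : ∀ᶠ y in 𝓝 z, Valued.v (g y) < Valued.v (h z) :=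
    hg.eventually (p := fun x ↦ Valued.v x < Valued.v (h z))
      (by rw [hg0]; exact Valued.setOf_v_lt_mem_nhds_zero hh0)
  have h2 : ∀ᶠ y in 𝓝 z, Valued.v (h y) = Valued.v (h z) :=
    hh.eventually (p := fun x ↦ Valued.v x = Valued.v (h z))
      (Valued.locally_const (by simpa using hh0))
  filter_upwards [h1, h2] with y hy1 hy2
  rwa [hy2]

end Valued

/-! ### Pointwise topology on algebra points -/

section Pointwise

variable {F A : Type*} [CommRing F] [CommRing A] [Algebra F A] [TopologicalSpace F]

/-- The topology of pointwise convergence on the set of `F`-points of an `F`-algebra. -/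
instance AlgHom.pointwiseTopology : TopologicalSpace (A →ₐ[F] F) :=
  .induced (fun φ ↦ (φ : A → F)) inferInstance

theorem AlgHom.continuous_apply (a : A) : Continuous fun φ : A →ₐ[F] F ↦ φ a :=
  (_root_.continuous_apply a).comp continuous_induced_dom

theorem AlgHom.continuous_of_apply {Z : Type*} [TopologicalSpace Z] {f : Z → A →ₐ[F] F}
    (h : ∀ a, Continuous fun z ↦ f z a) : Continuous f :=
  continuous_induced_rng.mpr (continuous_pi h)

theorem AlgHom.continuous_comp_right {B : Type*} [CommRing B] [Algebra F B] (g : A →ₐ[F] B) :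
    Continuous fun φ : B →ₐ[F] F ↦ φ.comp g :=
  AlgHom.continuous_of_apply fun a ↦ AlgHom.continuous_apply (g a)

theorem AlgHom.continuous_eval₂ [IsTopologicalRing F] (p : A[X]) :
    Continuous fun z : (A →ₐ[F] F) × F ↦ p.eval₂ (z.1 : A →+* F) z.2 := by
  simp only [eval₂_eq_sum_range]
  refine continuous_finsetSum _ fun i _ ↦ ?_
  exact ((AlgHom.continuous_apply _).comp continuous_fst).mul (continuous_snd.pow _)

end Pointwise

/-! ### Points of standard étale algebras -/

section StandardEtale

variable {F R S : Type*} [Field F] [CommRing R] [CommRing S] [Algebra F R] [Algebra F S]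
  [Algebra R S] [IsScalarTower F R S]

/-- An `F`-point of a standard étale algebra is an `F`-point of the base together with a
root of the defining polynomial. -/
theorem StandardEtalePresentation.exists_algHom_extending (P : StandardEtalePresentation R S)
    (φ : R →ₐ[F] F) (a : F) (hf : P.f.eval₂ (φ : R →+* F) a = 0)
    (hg : P.g.eval₂ (φ : R →+* F) a ≠ 0) :
    ∃ ψ : S →ₐ[F] F, ψ.comp (IsScalarTower.toAlgHom F R S) = φ ∧ ψ P.x = a := by
  let : Algebra R F := (φ : R →+* F).toAlgebra
  have hmap : P.P.HasMap a := ⟨hf, IsUnit.mk0 _ hg⟩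
  let ψ : S →ₐ[R] F := (P.P.lift a hmap).comp P.equivRing.toAlgHom
  have hψ : ∀ r, ψ (algebraMap R S r) = φ r := ψ.commutes
  refine ⟨{ (ψ : S →+* F) with commutes' := fun c ↦ ?_ }, ?_, ?_⟩
  · change ψ (algebraMap F S c) = _
    rw [IsScalarTower.algebraMap_apply F R S, hψ, φ.commutes]
  · ext r
    exact hψ r
  · change ψ P.x = a
    simp [ψ]

theorem AlgHom.eval₂_comp_toAlgHom (ψ : S →ₐ[F] F) (p : R[X]) (x : S) :
    p.eval₂ (ψ.comp (IsScalarTower.toAlgHom F R S) : R →+* F) (ψ x) = ψ (aeval x p) := by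
  rw [aeval_def]
  exact (hom_eval₂ p (algebraMap R S) (ψ : S →+* F) x).symm

/-- Every `s` satisfies `s * g(x) ^ n = p(x)`, so `ψ s` is a quotient of polynomial expressions in
`ψ P.x` with coefficients in the image of `R`. -/
theorem StandardEtalePresentation.isInducing (P : StandardEtalePresentation R S)
    [TopologicalSpace F] [IsTopologicalDivisionRing F] :
    IsInducing fun ψ : S →ₐ[F] F ↦ (ψ.comp (IsScalarTower.toAlgHom F R S), ψ P.x) := by
  refine ⟨le_antisymm (((AlgHom.continuous_comp_right _).prodMk
    (AlgHom.continuous_apply _)).le_induced) ?_⟩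
  set j := fun ψ : S →ₐ[F] F ↦ (ψ.comp (IsScalarTower.toAlgHom F R S), ψ P.x) with hj
  rw [← continuous_id_iff_le]
  let t : TopologicalSpace (S →ₐ[F] F) := .induced j inferInstance
  have hjc : Continuous j := continuous_induced_dom
  refine continuous_induced_rng.mpr (continuous_pi fun s ↦ ?_)
  obtain ⟨p, n, hp⟩ := P.exists_mul_aeval_x_g_pow_eq_aeval_x s
  have hg : ∀ ψ : S →ₐ[F] F, ψ (aeval P.x P.g) ≠ 0 := fun ψ ↦ (P.hasMap.2.map ψ).ne_zero
  have hcont : ∀ q : R[X], Continuous[t, _] fun ψ : S →ₐ[F] F ↦ ψ (aeval P.x q) := fun q ↦ by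
    simp only [← AlgHom.eval₂_comp_toAlgHom]
    exact (AlgHom.continuous_eval₂ q).comp hjc
  have : (fun ψ : S →ₐ[F] F ↦ ψ s) =
      fun ψ ↦ ψ (aeval P.x p) / ψ (aeval P.x P.g) ^ n := by
    ext ψ
    rw [eq_div_iff (pow_ne_zero _ (hg ψ)), ← map_pow, ← map_mul, hp]
  change Continuous[t, _] fun ψ : S →ₐ[F] F ↦ ψ s
  rw [this]
  exact (hcont p).div₀ ((hcont P.g).pow n) fun ψ ↦ pow_ne_zero _ (hg ψ)

theorem StandardEtalePresentation.exists_mem_nhds_injOn (P : StandardEtalePresentation R S)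
    [TopologicalSpace F] [IsTopologicalDivisionRing F] [T2Space F] (ψ₀ : S →ₐ[F] F) :
    ∃ W ∈ 𝓝 ψ₀, W.InjOn fun ψ : S →ₐ[F] F ↦ ψ.comp (IsScalarTower.toAlgHom F R S) := by
  -- The divided difference of `f` at the two values of `x`; on the diagonal it is `f'(x)`. For
  -- points over the same point of `R`, `D * (φ x - ψ x) = f(φ x) - f(ψ x) = 0`.
  let D : (S →ₐ[F] F) × (S →ₐ[F] F) → F := fun z ↦
    ∑ n ∈ Finset.range (P.f.natDegree + 1), z.1 (algebraMap R S (P.f.coeff n)) *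
      ∑ i ∈ Finset.range n, z.1 P.x ^ i * z.2 P.x ^ (n - 1 - i)
  have hD : Continuous D := by
    have h1 : ∀ s : S, Continuous fun z : (S →ₐ[F] F) × (S →ₐ[F] F) ↦ z.1 s :=
      fun s ↦ (AlgHom.continuous_apply s).comp continuous_fst
    have h2 : ∀ s : S, Continuous fun z : (S →ₐ[F] F) × (S →ₐ[F] F) ↦ z.2 s :=
      fun s ↦ (AlgHom.continuous_apply s).comp continuous_snd
    refine continuous_finsetSum _ fun n _ ↦ (h1 _).mul (continuous_finsetSum _ fun i _ ↦ ?_)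
    exact ((h1 _).pow _).mul ((h2 _).pow _)
  have hD0 : D (ψ₀, ψ₀) ≠ 0 := by
    have : D (ψ₀, ψ₀) = ψ₀ (aeval P.x P.f.derivative) := by
      conv_rhs => rw [P.f.as_sum_range_C_mul_X_pow]
      simp [D, geom_sum₂_self, derivative_X_pow]
    rw [this]
    exact (P.hasMap.isUnit_derivative_f.map ψ₀).ne_zero
  have hev : ∀ᶠ z in 𝓝 (ψ₀, ψ₀), D z ≠ 0 := hD.continuousAt.eventually_ne hD0
  rw [nhds_prod_eq, eventually_prod_iff] at hev
  obtain ⟨p, hp, q, hq, hpq⟩ := hev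
  refine ⟨_, inter_mem hp hq, fun φ hφ ψ hψ h ↦ ?_⟩
  have hR : ∀ r, φ (algebraMap R S r) = ψ (algebraMap R S r) := fun r ↦ congr($h r)
  have hx : φ P.x = ψ P.x := by
    have hsum : ∀ χ : S →ₐ[F] F, ∑ n ∈ Finset.range (P.f.natDegree + 1),
        χ (algebraMap R S (P.f.coeff n)) * χ P.x ^ n = 0 := fun χ ↦ by
      simpa [aeval_eq_sum_range, Algebra.smul_def] using congr(χ $(P.hasMap.1))
    have : D (φ, ψ) * (φ P.x - ψ P.x) = 0 := by
      have e := congr($(hsum φ) - $(hsum ψ))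
      simp only [← hR] at e
      rw [← Finset.sum_sub_distrib, sub_zero] at e
      rw [← e, Finset.sum_mul]
      exact Finset.sum_congr rfl fun n _ ↦ by rw [mul_assoc, geom_sum₂_mul, mul_sub]
    exact sub_eq_zero.mp ((mul_eq_zero.mp this).resolve_left (hpq hφ.1 hψ.2))
  have hq : ∀ q : R[X], φ (aeval P.x q) = ψ (aeval P.x q) := fun q ↦ by
    rw [← AlgHom.eval₂_comp_toAlgHom, ← AlgHom.eval₂_comp_toAlgHom, hx]
    exact congr(q.eval₂ ($h : R →+* F) _)
  ext s
  obtain ⟨p, n, hp⟩ := P.exists_mul_aeval_x_g_pow_eq_aeval_x s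
  have hφ := congr(φ $hp)
  have hψ := congr(ψ $hp)
  rw [map_mul, map_pow, hq, hq p, ← hψ, map_mul, map_pow] at hφ
  exact mul_right_cancel₀ (pow_ne_zero _ (P.hasMap.2.map ψ).ne_zero) hφ

end StandardEtale

/-! ### Persistence of roots and the affine case -/

section Henselian

variable {F R S : Type*} [Field F] [CommRing R] [CommRing S] [Algebra F R] [Algebra F S]
  [Algebra R S] [IsScalarTower F R S] {Γ₀ : Type*} [LinearOrderedCommGroupWithZero Γ₀]
  [Valued F Γ₀]

/-- Simple roots persist, and stay close, under small perturbations of the coefficients. -/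
theorem AlgHom.eventually_exists_root
    [HenselianLocalRing (Valued.v : Valuation F Γ₀).valuationSubring]
    (f : R[X]) (φ₀ : R →ₐ[F] F) (a : F) (h0 : f.eval₂ (φ₀ : R →+* F) a = 0)
    (h1 : f.derivative.eval₂ (φ₀ : R →+* F) a ≠ 0) {N : Set F} (hN : N ∈ 𝓝 a) :
    ∀ᶠ φ : R →ₐ[F] F in 𝓝 φ₀, ∃ b ∈ N, f.eval₂ (φ : R →+* F) b = 0 := by
  obtain ⟨d, hd, hdN⟩ := Valued.exists_setOf_v_lt_subset (Γ₀ := Γ₀) hN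
  -- Recentring at `a` makes coefficients `0` and `1` the values of `f` and `f'` at `a`. The first
  -- vanishes at `φ₀` and the second does not, so the Newton inequalities hold nearby.
  set T : R[X] := taylor (algebraMap F R a) f with hT
  have heval : ∀ (φ : R →ₐ[F] F) (p : R[X]),
      φ (p.eval (algebraMap F R a)) = p.eval₂ (φ : R →+* F) a := fun φ p ↦ by
    rw [← AlgHom.coe_toRingHom, ← eval₂_at_apply]
    simp
  have hT0 : φ₀ (T.coeff 0) = 0 := by rw [hT, taylor_coeff_zero, heval, h0]
  have hT1 : φ₀ (T.coeff 1) ≠ 0 := by rwa [hT, taylor_coeff_one, heval]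
  have hc : ∀ i, ContinuousAt (fun φ : R →ₐ[F] F ↦ φ (T.coeff i)) φ₀ := fun i ↦
    (AlgHom.continuous_apply _).continuousAt
  have e1 : ∀ᶠ φ : R →ₐ[F] F in 𝓝 φ₀, ∀ i ∈ Finset.range (T.natDegree + 1),
      Valued.v (φ (T.coeff (i + 2)) * φ (T.coeff 0) ^ (i + 1)) <
        Valued.v (φ (T.coeff 1) ^ (i + 2)) := by
    rw [Finset.eventually_all]
    intro i _
    exact Valued.eventually_v_lt ((hc _).mul ((hc 0).pow _)) ((hc 1).pow _) (by simp [hT0])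
      (pow_ne_zero _ hT1)
  -- The Newton root has valuation `v (c 0 / c 1)`; this makes it smaller than `v d`.
  have e2 : ∀ᶠ φ : R →ₐ[F] F in 𝓝 φ₀,
      Valued.v (φ (T.coeff 0)) < Valued.v (d * φ (T.coeff 1)) :=
    Valued.eventually_v_lt (hc 0) (continuousAt_const.mul (hc 1)) hT0 (mul_ne_zero hd hT1)
  have e3 : ∀ᶠ φ : R →ₐ[F] F in 𝓝 φ₀, φ (T.coeff 1) ≠ 0 := (hc 1).eventually_ne hT1
  filter_upwards [e1, e2, e3] with φ h1 h2 h3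
  obtain ⟨z, hz, hvz⟩ := Valuation.exists_eval_eq_zero_of_henselian Valued.v
    (T.map (φ : R →+* F)) (by simpa using h3) (by
      intro i hi
      simpa using h1 i (Finset.range_mono (Nat.succ_le_succ natDegree_map_le) hi))
  refine ⟨z + a, hdN _ ?_, ?_⟩
  · rw [add_sub_cancel_right, hvz, map_div₀, div_lt_iff₀ (by simpa [zero_lt_iff] using h3)]
    simpa using h2
  · rw [hT, map_taylor, taylor_eval, Polynomial.eval_map] at hz
    simpa using hz

theorem Algebra.IsStandardEtale.isLocalHomeomorph_comp [Algebra.IsStandardEtale R S]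
    [HenselianLocalRing (Valued.v : Valuation F Γ₀).valuationSubring] :
    IsLocalHomeomorph
      fun ψ : S →ₐ[F] F ↦ ψ.comp (IsScalarTower.toAlgHom F R S) := by
  obtain ⟨P⟩ := Algebra.IsStandardEtale.nonempty_standardEtalePresentation (R := R) (S := S)
  have hcont : Continuous fun ψ : S →ₐ[F] F ↦ ψ.comp (IsScalarTower.toAlgHom F R S) :=
    AlgHom.continuous_comp_right _
  have hopen : IsOpenMap fun ψ : S →ₐ[F] F ↦ ψ.comp (IsScalarTower.toAlgHom F R S) := by
    rw [isOpenMap_iff_nhds_le]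
    intro ψ₀ M hM
    rw [mem_map, P.isInducing.nhds_eq_comap, nhds_prod_eq, mem_comap] at hM
    obtain ⟨t, ht, htM⟩ := hM
    obtain ⟨N₁, hN₁, N₂, hN₂, hsub⟩ := mem_prod_iff.mp ht
    have hg : ∀ᶠ z in 𝓝 (ψ₀.comp (IsScalarTower.toAlgHom F R S)) ×ˢ 𝓝 (ψ₀ P.x),
        P.g.eval₂ (z.1 : R →+* F) z.2 ≠ 0 := by
      rw [← nhds_prod_eq]
      refine (AlgHom.continuous_eval₂ P.g).continuousAt.eventually_ne ?_
      rw [AlgHom.eval₂_comp_toAlgHom]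
      exact (P.hasMap.2.map ψ₀).ne_zero
    obtain ⟨p, hp, q, hq, hpq⟩ := eventually_prod_iff.mp hg
    have hroot := AlgHom.eventually_exists_root (Γ₀ := Γ₀) P.f
      (ψ₀.comp (IsScalarTower.toAlgHom F R S)) (ψ₀ P.x)
      (by rw [AlgHom.eval₂_comp_toAlgHom, P.hasMap.1, map_zero])
      (by rw [AlgHom.eval₂_comp_toAlgHom]; exact (P.hasMap.isUnit_derivative_f.map ψ₀).ne_zero)
      (inter_mem hN₂ hq)
    filter_upwards [hroot, hN₁, hp] with φ ⟨b, hb, hfb⟩ h1 h3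
    obtain ⟨ψ, hψ, hψx⟩ := P.exists_algHom_extending φ b hfb (hpq h3 hb.2)
    rw [← hψ]
    refine htM (hsub ⟨?_, ?_⟩)
    · simpa only [Set.mem_preimage, hψ] using h1
    · simpa only [Set.mem_preimage, hψx] using hb.1
  rw [isLocalHomeomorph_iff_isOpenEmbedding_restrict]
  intro ψ₀
  obtain ⟨W, hW, hinj⟩ := P.exists_mem_nhds_injOn ψ₀
  obtain ⟨V, hVW, hV, hψ₀⟩ := mem_nhds_iff.mp hW
  exact ⟨V, hV.mem_nhds hψ₀, .of_continuous_injective_isOpenMap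
    (hcont.comp continuous_subtype_val) (hinj.mono hVW).injective (hopen.domRestrict hV)⟩

end Henselian

/-! ### Rational points and evaluation of sections -/

namespace AlgebraicGeometry.Scheme.Hom

variable {X Y : Scheme.{u}}

theorem le_preimage_top (f : X ⟶ Y) (U : X.Opens) : U ≤ f ⁻¹ᵁ ⊤ :=
  fun _ _ ↦ trivial

theorem appLE_comp_ΓSpecIso_hom {U : X.Opens} (hU : IsAffineOpen U)
    {A : CommRingCat.{u}} (φ : Γ(X, U) ⟶ A) (e : ⊤ ≤ (Spec.map φ ≫ hU.fromSpec) ⁻¹ᵁ U) :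
    (Spec.map φ ≫ hU.fromSpec).appLE U ⊤ e ≫ (Scheme.ΓSpecIso A).hom = φ := by
  have e₁ : ⊤ ≤ Spec.map φ ⁻¹ᵁ (hU.fromSpec ⁻¹ᵁ U) := e
  have e₂ : ⊤ ≤ Spec.map φ ⁻¹ᵁ ⊤ := le_rfl
  have h₁ : (Spec.map φ ≫ hU.fromSpec).appLE U ⊤ e =
    hU.fromSpec.app U ≫ (Spec.map φ).appLE _ ⊤ e₁ := Scheme.Hom.comp_appLE ..
  have h₂ : (Spec.map φ).appLE ⊤ ⊤ e₂ = (Spec.map φ).appTop := Scheme.Hom.appLE_eq_app _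
  rw [h₁, hU.fromSpec_app_self, Category.assoc, Category.assoc, Scheme.Hom.map_appLE_assoc, h₂,
    Scheme.ΓSpecIso_naturality, Iso.inv_hom_id_assoc]

theorem appLE_comp_appLE_of_comp_eq_id {p : X ⟶ Y} {x : Y ⟶ X} (h : x ≫ p = 𝟙 Y) {U : X.Opens}
    (e : U ≤ p ⁻¹ᵁ ⊤) (hx : ⊤ ≤ x ⁻¹ᵁ U) : p.appLE ⊤ U e ≫ x.appLE U ⊤ hx = 𝟙 _ := by
  -- The proof argument of `appLE` depends on the morphism, so the equality is substituted for a
  -- variable `g`.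
  have hid : ∀ (g : Y ⟶ Y) (e : ⊤ ≤ g ⁻¹ᵁ ⊤), g = 𝟙 _ → g.appLE ⊤ ⊤ e = 𝟙 _ := by
    rintro _ e rfl
    simp only [Scheme.Hom.appLE, Scheme.Hom.id_app]
    exact Y.presheaf.map_id _
  rw [Scheme.Hom.appLE_comp_appLE]
  exact hid _ _ h

end AlgebraicGeometry.Scheme.Hom

namespace RationalPoints

variable {F : Type u} [Field F] {X Y : Over (specField F)}

/-- Sections of an `F`-scheme form an `F`-algebra. -/
noncomputable instance algebraSections (U : X.left.Opens) : Algebra F Γ(X.left, U) :=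
  RingHom.toAlgebra ((Scheme.ΓSpecIso (CommRingCat.of F)).inv ≫
    X.hom.appLE ⊤ U (X.hom.le_preimage_top U)).hom

theorem algebraMap_sections (U : X.left.Opens) :
    CommRingCat.ofHom (algebraMap F Γ(X.left, U)) =
      (Scheme.ΓSpecIso (CommRingCat.of F)).inv ≫ X.hom.appLE ⊤ U (X.hom.le_preimage_top U) := rfl

theorem liesIn_iff (x : RationalPoints X) (U : X.left.Opens) (p : specField F) :
    x.LiesIn U ↔ x.hom p ∈ U := by
  have : Subsingleton (specField F) := inferInstanceAs (Subsingleton (PrimeSpectrum F))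
  refine ⟨fun h ↦ h (Set.mem_univ p), fun h q _ ↦ ?_⟩
  rw [Subsingleton.elim q p]
  exact h

theorem hom_comp (x : RationalPoints X) : x.hom ≫ X.hom = 𝟙 (specField F) :=
  Over.w x

theorem hom_injective : Function.Injective (hom : RationalPoints X → _) :=
  fun _ _ h ↦ Over.OverMorphism.ext h

/-- Evaluation of regular functions at a rational point, as a homomorphism of `F`-algebras. -/
noncomputable def evalAlgHom (x : RationalPoints X) {U : X.left.Opens} (hx : x.LiesIn U) :
    Γ(X.left, U) →ₐ[F] F where
  __ := (x.hom.appLE U ⊤ hx ≫ (Scheme.ΓSpecIso (CommRingCat.of F)).hom).hom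
  commutes' c := by
    have h := Scheme.Hom.appLE_comp_appLE_of_comp_eq_id (hom_comp x) (X.hom.le_preimage_top U) hx
    have h' := congr($(h).hom ((Scheme.ΓSpecIso (CommRingCat.of F)).inv.hom c))
    refine congr((Scheme.ΓSpecIso (CommRingCat.of F)).hom.hom $h').trans ?_
    exact congr($((Scheme.ΓSpecIso (CommRingCat.of F)).inv_hom_id).hom c)

theorem evalAlgHom_apply (x : RationalPoints X) {U : X.left.Opens} (hx : x.LiesIn U)
    (s : Γ(X.left, U)) : x.evalAlgHom hx s = x.eval hx s := rfl

theorem LiesIn.mono {x : RationalPoints X} {U V : X.left.Opens} (hx : x.LiesIn U) (h : U ≤ V) :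
    x.LiesIn V :=
  le_trans hx fun _ hp ↦ h hp

theorem eval_map {x : RationalPoints X} {U V : X.left.Opens} (hx : x.LiesIn U) (h : U ≤ V)
    (s : Γ(X.left, V)) :
    x.eval hx (X.left.presheaf.map (homOfLE h).op s) = x.eval (hx.mono h) s := by
  have := x.hom.map_appLE hx (homOfLE h).op
  exact congr((Scheme.ΓSpecIso (CommRingCat.of F)).hom ($(this).hom s))

theorem liesIn_basicOpen_iff {x : RationalPoints X} {U : X.left.Opens} (hx : x.LiesIn U)
    (s : Γ(X.left, U)) : x.LiesIn (X.left.basicOpen s) ↔ x.eval hx s ≠ 0 := by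
  let p : specField F := (⊥ : PrimeSpectrum F)
  rw [liesIn_iff _ _ p]
  have h1 := Scheme.basicOpen_appLE x.hom ⊤ U hx s
  have h2 : p ∈ (specField F).basicOpen (x.hom.appLE U ⊤ hx s) ↔ x.eval hx s ≠ 0 := by
    rw [basicOpen_eq_of_affine']
    exact PrimeSpectrum.mem_basicOpen _ _
  rw [h1] at h2
  exact ⟨fun h ↦ h2.mp ⟨trivial, h⟩, fun h ↦ (h2.mpr h).2⟩

theorem LiesIn.map {x : RationalPoints X} {U : X.left.Opens} (hx : x.LiesIn U) (f : X ⟶ Y)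
    {V : Y.left.Opens} (h : U ≤ f.left ⁻¹ᵁ V) : (RationalPoints.map f x).LiesIn V :=
  hx.mono h

theorem eval_map_apply {x : RationalPoints X} {U : X.left.Opens} (hx : x.LiesIn U) (f : X ⟶ Y)
    {V : Y.left.Opens} (h : U ≤ f.left ⁻¹ᵁ V) (s : Γ(Y.left, V)) :
    (RationalPoints.map f x).eval (hx.map f h) s = x.eval hx (f.left.appLE V U h s) := by
  have := Scheme.Hom.appLE_comp_appLE x.hom f.left V U ⊤ h hx
  exact congr((Scheme.ΓSpecIso (CommRingCat.of F)).hom ($(this.symm).hom s))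

section Affine

variable {U : X.left.Opens} (hU : IsAffineOpen U)

/-- The rational point of an affine open defined by an `F`-point of its coordinate ring. -/
noncomputable def ofAlgHom (φ : Γ(X.left, U) →ₐ[F] F) : RationalPoints X :=
  Over.homMk (Spec.map (CommRingCat.ofHom (φ : Γ(X.left, U) →+* F)) ≫ hU.fromSpec) (by
    have h := (isAffineOpen_top (specField F)).SpecMap_appLE_fromSpec X.hom hU
      (X.hom.le_preimage_top U)
    have h' : CommRingCat.ofHom (algebraMap F Γ(X.left, U)) ≫
        CommRingCat.ofHom (φ : Γ(X.left, U) →+* F) = 𝟙 _ := by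
      ext c
      exact φ.commutes c
    change (Spec.map _ ≫ hU.fromSpec) ≫ X.hom = 𝟙 _
    rw [Category.assoc, ← h, IsAffineOpen.fromSpec_top, Scheme.isoSpec_Spec_inv, ← Spec.map_comp,
      ← Spec.map_comp, ← Spec.map_id, ← h', algebraMap_sections])

theorem ofAlgHom_hom (φ : Γ(X.left, U) →ₐ[F] F) : (ofAlgHom hU φ).hom =
    Spec.map (CommRingCat.ofHom (φ : Γ(X.left, U) →+* F)) ≫ hU.fromSpec := rfl

theorem ofAlgHom_liesIn (φ : Γ(X.left, U) →ₐ[F] F) : (ofAlgHom hU φ).LiesIn U := by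
  intro p _
  have : (ofAlgHom hU φ).hom p ∈ Set.range hU.fromSpec := by
    rw [ofAlgHom_hom]
    exact ⟨_, rfl⟩
  rwa [hU.range_fromSpec] at this

theorem evalAlgHom_ofAlgHom (φ : Γ(X.left, U) →ₐ[F] F) :
    (ofAlgHom hU φ).evalAlgHom (ofAlgHom_liesIn hU φ) = φ := by
  have h := Scheme.Hom.appLE_comp_ΓSpecIso_hom hU (CommRingCat.ofHom (φ : Γ(X.left, U) →+* F))
    (ofAlgHom_liesIn hU φ)
  ext a
  exact congr($(h).hom a)

include hU in
theorem eq_of_evalAlgHom_eq {x y : RationalPoints X} (hx : x.LiesIn U) (hy : y.LiesIn U)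
    (h : x.evalAlgHom hx = y.evalAlgHom hy) : x = y := by
  have hxy : x.hom.appLE U ⊤ hx = y.hom.appLE U ⊤ hy := by
    rw [← cancel_mono (Scheme.ΓSpecIso (CommRingCat.of F)).hom]
    ext a
    exact congr($h a)
  have h1 := hU.SpecMap_appLE_fromSpec x.hom (isAffineOpen_top _) hx
  have h2 := hU.SpecMap_appLE_fromSpec y.hom (isAffineOpen_top _) hy
  rw [hxy, h2] at h1
  refine hom_injective ((cancel_epi (isAffineOpen_top (specField F)).fromSpec).mp ?_)
  exact h1.symm

theorem ofAlgHom_evalAlgHom {x : RationalPoints X} (hx : x.LiesIn U) :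
    ofAlgHom hU (x.evalAlgHom hx) = x :=
  eq_of_evalAlgHom_eq hU _ hx (evalAlgHom_ofAlgHom hU _)

end Affine

/-- Sections over `D(b)` are fractions `a / b ^ n` with `a` in `Γ(U)`. This compares a function on
an arbitrary open `W` with functions on the affine chart. -/
theorem exists_eval_mul_pow_eq {U W : X.left.Opens} (hU : IsAffineOpen U) {b : Γ(X.left, U)}
    (hb : X.left.basicOpen b ≤ W) (s : Γ(X.left, W)) :
    ∃ (a : Γ(X.left, U)) (n : ℕ), ∀ (x : RationalPoints X) (hx : x.LiesIn U)
      (hxb : x.LiesIn (X.left.basicOpen b)),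
      x.eval (hxb.mono hb) s * x.eval hx b ^ n = x.eval hx a := by
  have hbU : X.left.basicOpen b ≤ U := X.left.basicOpen_le b
  have hloc := hU.isLocalization_basicOpen b
  obtain ⟨⟨a, ⟨_, n, rfl⟩⟩, ha⟩ := IsLocalization.surj (Submonoid.powers b)
    (X.left.presheaf.map (homOfLE hb).op s)
  replace ha : X.left.presheaf.map (homOfLE hb).op s *
    X.left.presheaf.map (homOfLE hbU).op (b ^ n) = X.left.presheaf.map (homOfLE hbU).op a := ha
  refine ⟨a, n, fun x hx hxb ↦ ?_⟩
  have := congr(x.evalAlgHom hxb $ha)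
  rw [map_mul, evalAlgHom_apply, evalAlgHom_apply, evalAlgHom_apply, eval_map, eval_map,
    eval_map, ← evalAlgHom_apply _ _ (b ^ n), map_pow] at this
  exact this

/-! ### Affine charts of the space of rational points -/

section Topology

variable [TopologicalSpace F]

theorem isOpen_setOf_eval_mem (U : X.left.Opens) (s : Γ(X.left, U)) {Ω : Set F}
    (hΩ : IsOpen Ω) : IsOpen {x : RationalPoints X | ∃ hx : x.LiesIn U, x.eval hx s ∈ Ω} :=
  TopologicalSpace.isOpen_generateFrom_of_mem ⟨U, s, Ω, hΩ, rfl⟩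

theorem isOpen_setOf_liesIn (U : X.left.Opens) : IsOpen {x : RationalPoints X | x.LiesIn U} := by
  simpa using isOpen_setOf_eval_mem U 0 isOpen_univ

theorem continuous_ofAlgHom [IsTopologicalDivisionRing F] [T1Space F] {U : X.left.Opens}
    (hU : IsAffineOpen U) : Continuous (ofAlgHom hU) := by
  refine continuous_generateFrom_iff.mpr ?_
  rintro _ ⟨W, s, Ω, hΩ, rfl⟩
  rw [isOpen_iff_mem_nhds]
  rintro φ₀ ⟨hφ₀, hs⟩
  let p : specField F := (default : PrimeSpectrum F)
  obtain ⟨b, hbW, hb⟩ := hU.exists_basicOpen_le (V := W) ⟨_, (liesIn_iff _ _ p).mp hφ₀⟩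
    ((liesIn_iff _ _ p).mp (ofAlgHom_liesIn hU φ₀))
  have hLies : ∀ φ, (ofAlgHom hU φ).LiesIn (X.left.basicOpen b) ↔ φ b ≠ 0 := fun φ ↦ by
    rw [liesIn_basicOpen_iff (ofAlgHom_liesIn hU φ), ← evalAlgHom_apply, evalAlgHom_ofAlgHom]
  obtain ⟨a, n, heval⟩ := exists_eval_mul_pow_eq hU hbW s
  replace heval : ∀ φ, ∀ h : (ofAlgHom hU φ).LiesIn W, φ b ≠ 0 →
      (ofAlgHom hU φ).eval h s = φ a / φ b ^ n := fun φ h hb0 ↦ by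
    have := heval _ (ofAlgHom_liesIn hU φ) ((hLies φ).mpr hb0)
    rw [← evalAlgHom_apply _ _ a, ← evalAlgHom_apply _ _ b, evalAlgHom_ofAlgHom] at this
    exact (eq_div_iff (pow_ne_zero _ hb0)).mpr this
  have hb0 : φ₀ b ≠ 0 := (hLies φ₀).mp ((liesIn_iff _ _ p).mpr hb)
  have hca : ContinuousAt (fun φ : Γ(X.left, U) →ₐ[F] F ↦ φ a / φ b ^ n) φ₀ :=
    (AlgHom.continuous_apply a).continuousAt.div₀
      ((AlgHom.continuous_apply b).pow n).continuousAt (pow_ne_zero _ hb0)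
  filter_upwards [(AlgHom.continuous_apply b).continuousAt.eventually_ne hb0,
    hca.eventually_mem (hΩ.mem_nhds (heval φ₀ hφ₀ hb0 ▸ hs))] with φ h1 h2
  have hL := ((hLies φ).mpr h1).mono hbW
  exact ⟨hL, (heval φ hL h1).symm ▸ h2⟩

theorem isOpenEmbedding_ofAlgHom [IsTopologicalDivisionRing F] [T1Space F] {U : X.left.Opens}
    (hU : IsAffineOpen U) : IsOpenEmbedding (ofAlgHom hU) := by
  have hrange : Set.range (ofAlgHom hU) = {x : RationalPoints X | x.LiesIn U} :=
    Set.eq_of_subset_of_subset (by rintro _ ⟨φ, rfl⟩; exact ofAlgHom_liesIn hU φ)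
      fun x hx ↦ ⟨_, ofAlgHom_evalAlgHom hU hx⟩
  refine ⟨⟨⟨le_antisymm (continuous_ofAlgHom hU).le_induced ?_⟩, ?_⟩, ?_⟩
  -- Conversely, evaluation at each `a` in `Γ(U)` is continuous for the induced topology, by the
  -- very subbasis defining the topology of `X(F)`.
  · rw [← continuous_id_iff_le]
    let t : TopologicalSpace (Γ(X.left, U) →ₐ[F] F) := .induced (ofAlgHom hU) inferInstance
    refine continuous_induced_rng.mpr (continuous_pi fun a ↦ ?_)
    change Continuous[t, _] fun φ : Γ(X.left, U) →ₐ[F] F ↦ φ a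
    refine ⟨fun Ω hΩ ↦ ⟨_, isOpen_setOf_eval_mem U a hΩ, ?_⟩⟩
    ext φ
    have : (ofAlgHom hU φ).eval (ofAlgHom_liesIn hU φ) a = φ a := by
      rw [← evalAlgHom_apply, evalAlgHom_ofAlgHom]
    simp [ofAlgHom_liesIn hU φ, this]
  · intro φ ψ h
    rw [← evalAlgHom_ofAlgHom hU φ, ← evalAlgHom_ofAlgHom hU ψ]
    congr!
  · rw [hrange]
    exact isOpen_setOf_liesIn U

end Topology

end RationalPoints

/-! ### Reduction to standard étale charts -/

theorem AlgebraicGeometry.Etale.exists_isStandardEtale_appLE {X Y : Scheme.{u}} (f : X ⟶ Y)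
    [Etale f] (x : X) :
    ∃ (V : Y.Opens) (_ : IsAffineOpen V) (U : X.Opens) (_ : IsAffineOpen U) (e : U ≤ f ⁻¹ᵁ V),
      x ∈ U ∧ @Algebra.IsStandardEtale Γ(Y, V) Γ(X, U) _ _ (f.appLE V U e).hom.toAlgebra := by
  obtain ⟨_, ⟨V, hV, rfl⟩, hxV, -⟩ := Y.isBasis_affineOpens.exists_subset_of_mem_open
    (Set.mem_univ (f x)) isOpen_univ
  obtain ⟨_, ⟨U, hU, rfl⟩, hxU, e : U ≤ f ⁻¹ᵁ V⟩ :=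
    X.isBasis_affineOpens.exists_subset_of_mem_open (show x ∈ (f ⁻¹ᵁ V : X.Opens) from hxV)
      (f ⁻¹ᵁ V).isOpen
  let _ : Algebra Γ(Y, V) Γ(X, U) := (f.appLE V U e).hom.toAlgebra
  have : Algebra.Etale Γ(Y, V) Γ(X, U) := f.etale_appLE hV hU e
  let Q := hU.primeIdealOf ⟨x, hxU⟩
  have : Algebra.IsEtaleAt Γ(Y, V) Q.asIdeal :=
    Algebra.FormallyEtale.comp _ Γ(X, U) _
  obtain ⟨s, hs, hstd⟩ := Algebra.IsEtaleAt.exists_isStandardEtale (R := Γ(Y, V)) Q.asIdeal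
  have hle : X.basicOpen s ≤ U := X.basicOpen_le s
  refine ⟨V, hV, X.basicOpen s, hU.basicOpen s, hle.trans e, ?_, ?_⟩
  · have h : Q ∈ PrimeSpectrum.basicOpen s := hs
    rw [← hU.fromSpec_preimage_basicOpen] at h
    have h' : hU.fromSpec Q ∈ X.basicOpen s := h
    rwa [hU.fromSpec_primeIdealOf] at h'
  · let _ : Algebra Γ(Y, V) Γ(X, X.basicOpen s) :=
      (f.appLE V (X.basicOpen s) (hle.trans e)).hom.toAlgebra
    have : IsScalarTower Γ(Y, V) Γ(X, U) Γ(X, X.basicOpen s) :=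
      .of_algebraMap_eq' congr($((f.appLE_map e (homOfLE hle).op).symm).hom)
    have := hU.isLocalization_basicOpen s
    exact .of_equiv ((IsLocalization.algEquiv (Submonoid.powers s) (Localization.Away s)
      Γ(X, X.basicOpen s)).restrictScalars Γ(Y, V))

theorem RationalPoints.isLocalHomeomorph_map {F : Type u} [Field F] {Γ₀ : Type v}
    [LinearOrderedCommGroupWithZero Γ₀] [Valued F Γ₀]
    [HenselianLocalRing (Valued.v : Valuation F Γ₀).valuationSubring]
    {X Y : Over (specField F)} (f : X ⟶ Y) [Etale f.left] :
    IsLocalHomeomorph (RationalPoints.map f) := by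
  rw [isLocalHomeomorph_iff_isLocalHomeomorphOn_univ]
  intro x _
  let p : specField F := (default : PrimeSpectrum F)
  obtain ⟨V, hV, U, hU, e, hxU, hstd⟩ := Etale.exists_isStandardEtale_appLE f.left (x.hom p)
  have hx : x.LiesIn U := (liesIn_iff x U p).mpr hxU
  let _ : Algebra Γ(Y.left, V) Γ(X.left, U) := (f.left.appLE V U e).hom.toAlgebra
  have : IsScalarTower F Γ(Y.left, V) Γ(X.left, U) := .of_algebraMap_eq' (by
    have h := Scheme.Hom.appLE_comp_appLE f.left Y.hom ⊤ V U (Y.hom.le_preimage_top V) e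
    have h' : ∀ (g : X.left ⟶ specField F) (e : U ≤ g ⁻¹ᵁ ⊤), g = X.hom →
        g.appLE ⊤ U e = X.hom.appLE ⊤ U (X.hom.le_preimage_top U) := by
      rintro _ _ rfl; rfl
    rw [h' _ _ (Over.w f)] at h
    exact congr(((Scheme.ΓSpecIso (CommRingCat.of F)).inv ≫ $(h.symm)).hom))
  have hsq : RationalPoints.map f ∘ ofAlgHom hU = ofAlgHom hV ∘
      fun ψ ↦ ψ.comp (IsScalarTower.toAlgHom F Γ(Y.left, V) Γ(X.left, U)) := by
    ext1 ψ
    refine eq_of_evalAlgHom_eq hV ((ofAlgHom_liesIn hU ψ).map f e) (ofAlgHom_liesIn hV _) ?_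
    simp only [Function.comp_apply]
    rw [evalAlgHom_ofAlgHom]
    ext s
    refine (eval_map_apply (ofAlgHom_liesIn hU ψ) f e s).trans ?_
    rw [← evalAlgHom_apply, evalAlgHom_ofAlgHom]
    rfl
  have hcomp : IsLocalHomeomorph (RationalPoints.map f ∘ ofAlgHom hU) := by
    rw [hsq]
    exact (isOpenEmbedding_ofAlgHom hV).isLocalHomeomorph.comp
      Algebra.IsStandardEtale.isLocalHomeomorph_comp
  -- The chart of `U` is a local homeomorphism, so it can be cancelled on its image, which contains
  -- `x`.
  have := (hcomp.isLocalHomeomorphOn (s := Set.univ)).of_comp_right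
    ((isOpenEmbedding_ofAlgHom hU).isLocalHomeomorph.isLocalHomeomorphOn)
  exact this x ⟨_, trivial, ofAlgHom_evalAlgHom hU hx⟩

theorem mainTheorem5 (F : Type u) [Field F] (Γ₀ : Type v) [LinearOrderedCommGroupWithZero Γ₀]
    [Valued F Γ₀] (hF : HenselianLocalRing (Valued.v : Valuation F Γ₀).valuationSubring) :
    IsTopologicallyHenselian F where
  isTopologicalDivisionRing := inferInstance
  t2Space := inferInstance
  isLocalHomeomorph_map _ _ _ _ f _ := RationalPoints.isLocalHomeomorph_map (Γ₀ := Γ₀) f
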